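/- Theorem 2 (serial decoding rate region). Consider the four-node network with links $1\to3$, $1\to4$, $2\to3$, $3\to4$, where link $i\to j$ is a memoryless binary symmetric channel with crossover probability $p_{i,j}\in[0,1]$ and the links are independent. At block length $n$ and rates $R_A,R_B\ge 0$, the messages $A\in\{1,\dots,\lfloor 2^{nR_A}\rfloor\}$ and $B\in\{1,\dots,\lfloor 2^{nR_B}\rfloor\}$ are independent and uniform. Node 1 sends the same codeword $\mathbf X_{1,3}(A)=\mathbf X_{1,4}(A)\in\{0,1\}^n$ on $1\to3$ and $1\to4$, node 2 sends $\mathbf X_{2,3}(B)\in\{0,1\}^n$ on $2\to3$, and node 3 sends $\mathbf X_{3,4}=\mathbf Y_{1,3}\oplus\mathbf Y_{2,3}$ on $3\to4$, where $\mathbf Y_{i,j}$ is the output of link $i\to j$. In serial decoding, node 4 computes an estimate $\hat A$ from $\mathbf Y_{1,4}$ alone, and then an estimate $\hat B$ from $\mathbf Y_{3,4}\oplus\mathbf X_{1,3}(\hat A)$ alone. A pair $(R_A,R_B)$ with $R_A,R_B\ge0$ is achievable if for every $\varepsilon>0$ and all sufficiently large $n$ there are encoders and decoders of this kind with $\Pr\{(\hat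 A,\hat B)\ne(A,B)\}<\varepsilon$; the achievable rate region $\Lambda_{\mathrm{serial}}$ is the closure of the set of achievable pairs. Let $$p'=[(1-p_{1,3})(1-p_{2,3})+p_{1,3}p_{2,3}]\,p_{3,4}+[p_{1,3}(1-p_{2,3})+(1-p_{1,3})p_{2,3}]\,(1-p_{3,4}),$$ and let $H(p)=-p\log_2p-(1-p)\log_2(1-p)$, with $0\log_2 0=0$. Then the cascade of the links $1\to3$, $2\to3$, $3\to4$ is, as a channel from $\mathbf X_{1,3}\oplus\mathbf X_{2,3}$ to $\mathbf Y_{3,4}$, a memoryless binary symmetric channel with crossover probability $p'$, and $\Lambda_{\mathrm{serial}}$ is the convex hull of all $(R_A,R_B)$ with $R_A,R_B\ge0$ that satisfy $$R_A\le \mathbb C_{1,4}=1-H(p_{1,4}),\qquad R_B\le\mathbb C'=1-H(p').$$ This holds both when the encoders are required to be linear and when they are arbitrary. Here an encoder of $M$ messages is linear if the messages are labelled by distinct vectors $\mathbf u\in\{0,1\}^{k}$ with $k=\lceil\log_2 M\rceil$ and are encoded as $\mathbf uG$, where $G$ is a binary $k\times n$ matrix with linearly independent rows. -/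

import Mathlib

namespace SerialDecoding

/-- Binary words of length `n`; the bit-wise XOR is the addition. -/
abbrev Word (n : ℕ) : Type := Fin n → ZMod 2

/-- An encoder: a codeword of length `n` for each of `M` messages. -/
abbrev Codebook (n M : ℕ) : Type := Fin M → Word n

/-- Transition probability `Pr{Y = y | X = x}` of `n` uses of the memoryless binary symmetric
channel with crossover probability `p`. -/
noncomputable def bsc (p : ℝ) {n : ℕ} (x y : Word n) : ℝ :=
  ∏ i, if y i = x i then 1 - p else p

/-- The number `⌊2 ^ (n R)⌋` of messages at rate `R` and block length `n`. -/
noncomputable def numMessages (n : ℕ) (R : ℝ) : ℕ := ⌊(2 : ℝ) ^ ((n : ℝ) * R)⌋₊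

/-- The encoder maps into a binary linear code: the `M` messages are labelled by distinct binary
vectors `u` of the least possible length `k = ⌈log₂ M⌉`, and are encoded as `u G`, where the
generator matrix `G` has linearly independent rows. -/
def IsLinearCodebook {n M : ℕ} (X : Codebook n M) : Prop :=
  ∃ (G : Matrix (Fin (Nat.clog 2 M)) (Fin n) (ZMod 2)) (u : Fin M → Word (Nat.clog 2 M)),
    LinearIndependent (ZMod 2) G.row ∧ Function.Injective u ∧ ∀ m, X m = Matrix.vecMul (u m) G

/-- The class of linear encoders. -/
def linearCodes (n M : ℕ) : Set (Codebook n M) := {X | IsLinearCodebook X}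

/-- The class of all encoders. -/
def allCodes (n M : ℕ) : Set (Codebook n M) := Set.univ

open Classical in
/-- `Pr{(Â, B̂) ≠ (A, B)}` under serial decoding. The messages `A`, `B` are independent and uniform.
Node 1 sends `XA A` on the links `1 → 3` and `1 → 4`, node 2 sends `XB B` on `2 → 3`, and node 3
sends `Y₁₃ + Y₂₃` on `3 → 4`; the links are independent. Node 4 computes `Â = decA Y₁₄`, subtracts
the re-encoded `XA Â` from `Y₃₄` and computes `B̂ = decB (Y₃₄ - XA Â)`. -/
noncomputable def serialErrorProb (p13 p14 p23 p34 : ℝ) {n MA MB : ℕ}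
    (XA : Codebook n MA) (XB : Codebook n MB)
    (decA : Word n → Fin MA) (decB : Word n → Fin MB) : ℝ :=
  ∑ a : Fin MA, ∑ b : Fin MB, ((MA : ℝ)⁻¹ * (MB : ℝ)⁻¹) *
    ∑ y13 : Word n, ∑ y14 : Word n, ∑ y23 : Word n, ∑ y34 : Word n,
      bsc p13 (XA a) y13 * bsc p14 (XA a) y14 * bsc p23 (XB b) y23 * bsc p34 (y13 + y23) y34 *
        (if (decA y14, decB (y34 - XA (decA y14))) ≠ (a, b) then 1 else 0)

/-- The rate pair `(R.1, R.2) = (R_A, R_B)` is achievable by serial decoding with encoders from the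
class `codes`: the error probability can be made arbitrarily small for all large block lengths. -/
def SerialAchievable (codes : ∀ n M : ℕ, Set (Codebook n M)) (p13 p14 p23 p34 : ℝ)
    (R : ℝ × ℝ) : Prop :=
  0 ≤ R.1 ∧ 0 ≤ R.2 ∧ ∀ ε : ℝ, 0 < ε → ∃ N : ℕ, ∀ n : ℕ, N ≤ n →
    ∃ XA ∈ codes n (numMessages n R.1), ∃ XB ∈ codes n (numMessages n R.2),
      ∃ (decA : Word n → Fin (numMessages n R.1)) (decB : Word n → Fin (numMessages n R.2)),
        serialErrorProb p13 p14 p23 p34 XA XB decA decB < ε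

/-- The achievable rate region of serial decoding: the closure of the set of achievable pairs. -/
def serialRegion (codes : ∀ n M : ℕ, Set (Codebook n M)) (p13 p14 p23 p34 : ℝ) : Set (ℝ × ℝ) :=
  closure {R | SerialAchievable codes p13 p14 p23 p34 R}

/-- `1 - H(p)`, with the binary entropy `H` in bits. -/
noncomputable def bscCapacity (p : ℝ) : ℝ := 1 - Real.binEntropy p / Real.log 2

/-- The crossover probability `p'` of the cascade of the links `1 → 3`, `2 → 3` and `3 → 4`. -/
def cascadeCrossover (p13 p23 p34 : ℝ) : ℝ :=
  ((1 - p13) * (1 - p23) + p13 * p23) * p34 + (p13 * (1 - p23) + (1 - p13) * p23) * (1 - p34)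

end SerialDecoding

/-! Serial decoding splits into two independent point-to-point problems. If the estimate of $A$ is
wrong, the pair is already wrong, so the error event is unchanged when the true codeword of $A$ is
subtracted at node 4. What remains of the relay path is a binary symmetric channel with crossover
$p'$ and input the codeword of $B$ (`sum_relay_mul`, `serialErrorProb_eq`). The serial error
probability is thus at least each of the two single-link errors and at most their sum.

The rest is the coding theorem for one binary symmetric channel, by weak typicality. Converse:
decoding regions are disjoint and typical noise words have small probability
(`one_sub_bscErrorProb_le`). Direct part: a linear code is found by averaging over multiplications
in the field with $2^n$ elements (`exists_linear_bscErrorProb_le`). The direct part uses linear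
codes and the converse admits all codes, so both regions are the same box. -/

namespace SerialDecoding

/-! ### Additive noise and the cascade channel -/

section Channel

/-- The law of one noise bit of the binary symmetric channel. -/
noncomputable def flipProb (p : ℝ) (b : ZMod 2) : ℝ := if b = 0 then 1 - p else p

theorem sum_zmod_two {M : Type*} [AddCommMonoid M] (f : ZMod 2 → M) :
    ∑ b, f b = f 0 + f 1 := Fin.sum_univ_two f

theorem flipProb_nonneg {p : ℝ} (hp : p ∈ Set.Icc (0 : ℝ) 1) (b : ZMod 2) : 0 ≤ flipProb p b := by
  unfold flipProb
  split_ifs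
  · linarith [hp.2]
  · exact hp.1

theorem sum_flipProb (p : ℝ) : ∑ b, flipProb p b = 1 := by
  simp [sum_zmod_two, flipProb]

theorem sum_flipProb_mul_neg_log (p : ℝ) :
    ∑ b, flipProb p b * -Real.log (flipProb p b) = Real.binEntropy p := by
  simp [sum_zmod_two, flipProb, Real.binEntropy, Real.log_inv, add_comm]

theorem bsc_eq_prod_flipProb (p : ℝ) {n : ℕ} (x y : Word n) :
    bsc p x y = ∏ i, flipProb p ((y - x) i) := by
  simp [bsc, flipProb, sub_eq_zero]

theorem bsc_nonneg {p : ℝ} (hp : p ∈ Set.Icc (0 : ℝ) 1) {n : ℕ} (x y : Word n) :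
    0 ≤ bsc p x y := by
  rw [bsc_eq_prod_flipProb]
  exact Finset.prod_nonneg fun i _ => flipProb_nonneg hp _

/-- The noise $z = y - x$ has a law that does not depend on the input. -/
theorem sum_bsc_mul (p : ℝ) {n : ℕ} (x : Word n) (F : Word n → ℝ) :
    ∑ y, bsc p x y * F y = ∑ z : Word n, (∏ i, flipProb p (z i)) * F (x + z) := by
  rw [← Equiv.sum_comp (Equiv.addLeft x)]
  refine Finset.sum_congr rfl fun z _ => ?_
  simp [bsc_eq_prod_flipProb]

theorem cascade_bit (p q r : ℝ) (x x' y : ZMod 2) :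
    ∑ a : ZMod 2, ∑ b : ZMod 2, (if a = x then 1 - p else p) * (if b = x' then 1 - q else q) *
      (if y = a + b then 1 - r else r) =
    if y = x + x' then 1 - cascadeCrossover p q r else cascadeCrossover p q r := by
  have h : ∀ c : ZMod 2, c = 0 ∨ c = 1 := by decide
  have h2 : (1 : ZMod 2) + 1 = 0 := by decide
  rcases h x with rfl | rfl <;> rcases h x' with rfl | rfl <;> rcases h y with rfl | rfl <;>
    simp [sum_zmod_two, cascadeCrossover, h2] <;> ring

/-- All three links act bit by bit, so the sum over words factors into the one-bit sums of
`cascade_bit`. -/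
theorem cascade_eq_bsc (p q r : ℝ) {n : ℕ} (x x' y : Word n) :
    ∑ a : Word n, ∑ b : Word n, bsc p x a * bsc q x' b * bsc r (a + b) y =
      bsc (cascadeCrossover p q r) (x + x') y := by
  have h (a b : Word n) : bsc p x a * bsc q x' b * bsc r (a + b) y =
      ∏ i, ((if a i = x i then 1 - p else p) * (if b i = x' i then 1 - q else q) *
        (if y i = a i + b i then 1 - r else r)) := by
    simp only [bsc, Finset.prod_mul_distrib, Pi.add_apply]
  simp_rw [h, bsc, Pi.add_apply, ← cascade_bit]
  rw [Fintype.prod_sum]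
  refine Finset.sum_congr rfl fun a _ => ?_
  rw [Fintype.prod_sum]

theorem cascadeCrossover_mem {p q r : ℝ} (hp : p ∈ Set.Icc (0 : ℝ) 1)
    (hq : q ∈ Set.Icc (0 : ℝ) 1) (hr : r ∈ Set.Icc (0 : ℝ) 1) :
    cascadeCrossover p q r ∈ Set.Icc (0 : ℝ) 1 := by
  obtain ⟨hp0, hp1⟩ := hp
  obtain ⟨hq0, hq1⟩ := hq
  obtain ⟨hr0, hr1⟩ := hr
  have p1 := sub_nonneg.2 hp1
  have q1 := sub_nonneg.2 hq1
  have r1 := sub_nonneg.2 hr1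
  constructor
  · unfold cascadeCrossover
    positivity
  -- The right-hand side is $1 - p'$.
  · have : 0 ≤ ((1 - p) * (1 - q) + p * q) * (1 - r) + (p * (1 - q) + (1 - p) * q) * r := by
      positivity
    unfold cascadeCrossover
    linarith

end Channel

/-! ### Moments of sums of independent variables -/

section Moments

variable {α : Type*} [Fintype α] (w g : α → ℝ)

theorem sum_fin_succ_fun {M : Type*} [AddCommMonoid M] (n : ℕ) (F : (Fin (n + 1) → α) → M) :
    ∑ z, F z = ∑ a, ∑ z : Fin n → α, F (Fin.cons a z) := by
  rw [← (Fin.consEquiv fun _ : Fin (n + 1) => α).sum_comp, Fintype.sum_prod_type]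
  rfl

theorem sum_prod_weight (hw : ∑ a, w a = 1) (n : ℕ) :
    ∑ z : Fin n → α, ∏ i, w (z i) = 1 := by
  rw [← Fintype.prod_sum]
  simp [hw]

theorem sum_prod_weight_mul_sum (hw : ∑ a, w a = 1) (hg : ∑ a, w a * g a = 0) (n : ℕ) :
    ∑ z : Fin n → α, (∏ i, w (z i)) * ∑ i, g (z i) = 0 := by
  induction n with
  | zero => simp
  | succ n ih =>
    rw [sum_fin_succ_fun]
    have h (a : α) : ∑ z : Fin n → α, (∏ i, w ((Fin.cons a z : Fin (n + 1) → α) i)) *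
        ∑ i, g ((Fin.cons a z : Fin (n + 1) → α) i) = w a * g a := by
      simp only [Fin.prod_univ_succ, Fin.sum_univ_succ, Fin.cons_zero, Fin.cons_succ]
      calc _ = ∑ z : Fin n → α, (w a * g a * (∏ i, w (z i)) +
            w a * ((∏ i, w (z i)) * ∑ i, g (z i))) :=
            Finset.sum_congr rfl fun z _ => by ring
        _ = _ := by
          rw [Finset.sum_add_distrib, ← Finset.mul_sum, ← Finset.mul_sum, ih,
            sum_prod_weight w hw]
          ring
    simp_rw [h, hg]

/-- The variance of a sum of independent centred variables. -/
theorem sum_prod_weight_mul_sq_sum (hw : ∑ a, w a = 1) (hg : ∑ a, w a * g a = 0) (n : ℕ) :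
    ∑ z : Fin n → α, (∏ i, w (z i)) * (∑ i, g (z i)) ^ 2 = n * ∑ a, w a * g a ^ 2 := by
  induction n with
  | zero => simp
  | succ n ih =>
    rw [sum_fin_succ_fun]
    have h (a : α) : ∑ z : Fin n → α, (∏ i, w ((Fin.cons a z : Fin (n + 1) → α) i)) *
        (∑ i, g ((Fin.cons a z : Fin (n + 1) → α) i)) ^ 2 =
          w a * g a ^ 2 + w a * (n * ∑ a, w a * g a ^ 2) := by
      simp only [Fin.prod_univ_succ, Fin.sum_univ_succ, Fin.cons_zero, Fin.cons_succ]
      calc _ = ∑ z : Fin n → α, (w a * g a ^ 2 * (∏ i, w (z i)) +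
            2 * w a * g a * ((∏ i, w (z i)) * ∑ i, g (z i)) +
            w a * ((∏ i, w (z i)) * (∑ i, g (z i)) ^ 2)) :=
            Finset.sum_congr rfl fun z _ => by ring
        _ = _ := by
          rw [Finset.sum_add_distrib, Finset.sum_add_distrib, ← Finset.mul_sum,
            ← Finset.mul_sum, ← Finset.mul_sum, ih, sum_prod_weight w hw,
            sum_prod_weight_mul_sum w g hw hg]
          ring
    simp_rw [h, Finset.sum_add_distrib, ← Finset.sum_mul, hw]
    push_cast
    ring

end Moments

/-! ### Typical noise words -/

section Typical

theorem sum_bsc (p : ℝ) {n : ℕ} (x : Word n) : ∑ y, bsc p x y = 1 := by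
  have h := sum_bsc_mul p x fun _ => 1
  simp only [mul_one] at h
  rw [h, sum_prod_weight _ (sum_flipProb p)]

/-- The noise words of positive probability whose information content deviates from its mean by at
most `n * δ`. -/
def typicalSet (p δ : ℝ) (n : ℕ) : Set (Word n) :=
  {z | 0 < ∏ i, flipProb p (z i) ∧
    |Real.log (∏ i, flipProb p (z i)) + n * Real.binEntropy p| ≤ n * δ}

/-- The variance of the information content of one noise bit. -/
noncomputable def infoVariance (p : ℝ) : ℝ :=
  ∑ b, flipProb p b * (Real.log (flipProb p b) + Real.binEntropy p) ^ 2

open Classical in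
-- Chebyshev's inequality for the information content of the noise word.
theorem sum_not_typical_le {p δ : ℝ} (hp : p ∈ Set.Icc (0 : ℝ) 1) (hδ : 0 < δ) {n : ℕ}
    (hn : 0 < n) :
    ∑ z : Word n, (∏ i, flipProb p (z i)) * (if z ∈ typicalSet p δ n then 0 else 1) ≤
      infoVariance p / (n * δ ^ 2) := by
  have hn' : (0 : ℝ) < n := by exact_mod_cast hn
  have hc : ∑ b, flipProb p b * (Real.log (flipProb p b) + Real.binEntropy p) = 0 := by
    have h := sum_flipProb_mul_neg_log p
    simp_rw [mul_neg, Finset.sum_neg_distrib] at h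
    simp_rw [mul_add, Finset.sum_add_distrib, ← Finset.sum_mul, sum_flipProb]
    linarith
  have hv := sum_prod_weight_mul_sq_sum (flipProb p)
    (fun b => Real.log (flipProb p b) + Real.binEntropy p) (sum_flipProb p) hc n
  -- The extra factor $n$ completes $n\delta^2$ to the squared deviation $(n\delta)^2$.
  rw [le_div_iff₀ (by positivity), ← mul_le_mul_iff_right₀ hn']
  refine le_of_le_of_eq ?_ hv
  rw [Finset.sum_mul, Finset.mul_sum]
  refine Finset.sum_le_sum fun z _ => ?_
  have h0 : 0 ≤ ∏ i, flipProb p (z i) := Finset.prod_nonneg fun i _ => flipProb_nonneg hp _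
  by_cases hz : z ∈ typicalSet p δ n
  · simp only [hz, if_true]
    have : 0 ≤ (∏ i, flipProb p (z i)) *
      (∑ i, (Real.log (flipProb p (z i)) + Real.binEntropy p)) ^ 2 := by positivity
    simpa using this
  · simp only [hz, if_false]
    -- Words of probability zero carry no weight; on the others every factor is nonzero and the
    -- logarithm splits.
    rcases h0.eq_or_lt with h | h
    · simp [← h]
    · have hlog : Real.log (∏ i, flipProb p (z i)) = ∑ i, Real.log (flipProb p (z i)) :=
        Real.log_prod fun i _ hi => h.ne' (Finset.prod_eq_zero (Finset.mem_univ i) hi)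
      have hlt : n * δ < |∑ i, (Real.log (flipProb p (z i)) + Real.binEntropy p)| := by
        by_contra hle
        refine hz ⟨h, ?_⟩
        rw [hlog]
        simpa [Finset.sum_add_distrib] using hle
      have hsq : (n * δ) ^ 2 ≤ (∑ i, (Real.log (flipProb p (z i)) + Real.binEntropy p)) ^ 2 := by
        rw [← sq_abs (∑ i, _)]
        exact pow_le_pow_left₀ (by positivity) hlt.le 2
      calc _ = (∏ i, flipProb p (z i)) * (n * δ) ^ 2 := by ring
        _ ≤ _ := mul_le_mul_of_nonneg_left hsq h0

theorem le_of_mem_typicalSet {p δ : ℝ} {n : ℕ} {z : Word n} (hz : z ∈ typicalSet p δ n) :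
    Real.exp (-(n * (Real.binEntropy p + δ))) ≤ ∏ i, flipProb p (z i) := by
  rw [← Real.le_log_iff_exp_le hz.1]
  have := (abs_le.1 hz.2).1
  linarith

theorem prod_le_of_mem_typicalSet {p δ : ℝ} {n : ℕ} {z : Word n} (hz : z ∈ typicalSet p δ n) :
    ∏ i, flipProb p (z i) ≤ Real.exp (-(n * (Real.binEntropy p - δ))) := by
  rw [← Real.log_le_iff_le_exp hz.1]
  have := (abs_le.1 hz.2).2
  linarith

open Classical in
-- Each typical word has probability at least $e^{-n(H+\delta)}$, with $H$ in nats, and the total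
-- mass is one.
theorem sum_typical_le {p δ : ℝ} (hp : p ∈ Set.Icc (0 : ℝ) 1) (n : ℕ) :
    ∑ z : Word n, (if z ∈ typicalSet p δ n then (1 : ℝ) else 0) ≤
      Real.exp (n * (Real.binEntropy p + δ)) := by
  have h : ∑ z : Word n, (if z ∈ typicalSet p δ n then (1 : ℝ) else 0) ≤
      ∑ z : Word n, Real.exp (n * (Real.binEntropy p + δ)) * ∏ i, flipProb p (z i) := by
    refine Finset.sum_le_sum fun z _ => ?_
    split_ifs with hz
    · calc (1 : ℝ) = Real.exp (n * (Real.binEntropy p + δ)) *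
            Real.exp (-(n * (Real.binEntropy p + δ))) := by rw [← Real.exp_add]; simp
        _ ≤ _ := mul_le_mul_of_nonneg_left (le_of_mem_typicalSet hz) (Real.exp_pos _).le
    · exact mul_nonneg (Real.exp_pos _).le
        (Finset.prod_nonneg fun i _ => flipProb_nonneg hp _)
  rwa [← Finset.mul_sum, sum_prod_weight _ (sum_flipProb p), mul_one] at h

end Typical

/-! ### Converse for a single channel -/

section PointToPoint

open Classical in
/-- The error probability of a code over a single binary symmetric channel. -/
noncomputable def bscErrorProb (p : ℝ) {n M : ℕ} (X : Codebook n M) (dec : Word n → Fin M) : ℝ :=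
  ∑ m : Fin M, (M : ℝ)⁻¹ * ∑ y : Word n, bsc p (X m) y * (if dec y ≠ m then 1 else 0)

theorem numMessages_le (n : ℕ) (R : ℝ) :
    (numMessages n R : ℝ) ≤ Real.exp (n * (R * Real.log 2)) := by
  refine (Nat.floor_le (by positivity)).trans_eq ?_
  rw [Real.rpow_def_of_pos two_pos]
  ring_nf

theorem one_le_numMessages (n : ℕ) {R : ℝ} (hR : 0 ≤ R) : 1 ≤ numMessages n R :=
  Nat.one_le_floor_iff _ |>.2 (Real.one_le_rpow one_le_two (by positivity))

/-- Rounding costs at most a factor 2: $x < \lfloor x\rfloor + 1 \le 2\lfloor x\rfloor$ once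
$\lfloor x\rfloor \ge 1$. -/
theorem le_two_mul_numMessages (n : ℕ) {R : ℝ} (hR : 0 ≤ R) :
    Real.exp (n * (R * Real.log 2)) ≤ 2 * numMessages n R := by
  have h1 : (1 : ℝ) ≤ numMessages n R := by exact_mod_cast one_le_numMessages n hR
  have h2 := Nat.lt_floor_add_one ((2 : ℝ) ^ ((n : ℝ) * R))
  rw [Real.rpow_def_of_pos two_pos] at h2
  unfold numMessages at *
  rw [Real.rpow_def_of_pos two_pos] at *
  rw [show (n : ℝ) * (R * Real.log 2) = Real.log 2 * (n * R) by ring]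
  linarith

open Classical in
/-- A code over the binary symmetric channel succeeds with at most this probability. -/
theorem one_sub_bscErrorProb_le {p δ : ℝ} (hp : p ∈ Set.Icc (0 : ℝ) 1) (hδ : 0 < δ) {n M : ℕ}
    (hn : 0 < n) (hM : 0 < M) (X : Codebook n M) (dec : Word n → Fin M) :
    1 - bscErrorProb p X dec ≤ infoVariance p / (n * δ ^ 2) +
      (M : ℝ)⁻¹ * (2 ^ n * Real.exp (-(n * (Real.binEntropy p - δ)))) := by
  have hM' : (0 : ℝ) < M := by exact_mod_cast hM
  set c := Real.exp (-(n * (Real.binEntropy p - δ))) with hc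
  have hone (V : ℝ) : ∑ _m : Fin M, (M : ℝ)⁻¹ * V = V := by
    simp [hM'.ne']
  -- A noise word leading to correct decoding is either atypical or has probability at most `c`.
  have hmsg (m : Fin M) : 1 - ∑ y : Word n, bsc p (X m) y * (if dec y ≠ m then 1 else 0) ≤
      infoVariance p / (n * δ ^ 2) + ∑ y : Word n, (if dec y = m then c else 0) := by
    have e : 1 - ∑ y : Word n, bsc p (X m) y * (if dec y ≠ m then 1 else 0) =
        ∑ y : Word n, bsc p (X m) y * (if dec y = m then 1 else 0) := by
      nth_rewrite 1 [← sum_bsc p (X m)]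
      rw [← Finset.sum_sub_distrib]
      refine Finset.sum_congr rfl fun y _ => ?_
      by_cases h : dec y = m <;> simp [h]
    rw [e, sum_bsc_mul]
    have t := sum_not_typical_le hp hδ hn
    have t2 : ∑ y : Word n, (if dec y = m then c else 0) =
        ∑ z : Word n, (if dec (X m + z) = m then c else 0) :=
      (Equiv.sum_comp (Equiv.addLeft (X m)) fun y => if dec y = m then c else 0).symm
    rw [t2]
    refine le_trans ?_ (add_le_add_left t _)
    rw [← Finset.sum_add_distrib]
    refine Finset.sum_le_sum fun z _ => ?_
    have h0 : 0 ≤ ∏ i, flipProb p (z i) := Finset.prod_nonneg fun i _ => flipProb_nonneg hp _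
    have hc0 : 0 < c := Real.exp_pos _
    by_cases hd : dec (X m + z) = m <;> by_cases hz : z ∈ typicalSet p δ n
    · simpa [hd, hz] using prod_le_of_mem_typicalSet hz
    · simpa [hd, hz] using hc0.le
    · simp [hd, hz]
    · simpa [hd, hz] using h0
  calc 1 - bscErrorProb p X dec
      = ∑ m : Fin M, (M : ℝ)⁻¹ *
          (1 - ∑ y : Word n, bsc p (X m) y * (if dec y ≠ m then 1 else 0)) := by
        simp_rw [mul_sub, Finset.sum_sub_distrib]
        rw [hone 1, bscErrorProb]
    _ ≤ ∑ m : Fin M, (M : ℝ)⁻¹ * (infoVariance p / (n * δ ^ 2) +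
          ∑ y : Word n, (if dec y = m then c else 0)) :=
        Finset.sum_le_sum fun m _ => mul_le_mul_of_nonneg_left (hmsg m) (by positivity)
    -- Each of the $2^n$ outputs is decoded to exactly one message, so the swapped double sum is
    -- $2^n c$.
    _ = _ := by
        simp_rw [mul_add, Finset.sum_add_distrib]
        rw [hone, ← Finset.mul_sum, Finset.sum_comm]
        simp

theorem tendsto_div_nat_mul (a b : ℝ) :
    Filter.Tendsto (fun n : ℕ => a / (n * b)) Filter.atTop (nhds 0) := by
  have h := (tendsto_const_div_atTop_nhds_zero_nat a).div_const b
  simpa [div_div] using h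

theorem tendsto_exp_neg_nat_mul {δ : ℝ} (hδ : 0 < δ) :
    Filter.Tendsto (fun n : ℕ => 2 * Real.exp (-(n * δ))) Filter.atTop (nhds 0) := by
  have h : Filter.Tendsto (fun n : ℕ => (n : ℝ) * δ) Filter.atTop Filter.atTop :=
    tendsto_natCast_atTop_atTop.atTop_mul_const hδ
  simpa using (Real.tendsto_exp_neg_atTop_nhds_zero.comp h).const_mul 2

theorem log_two_mul_bscCapacity (p : ℝ) :
    bscCapacity p * Real.log 2 = Real.log 2 - Real.binEntropy p := by
  have : Real.log 2 ≠ 0 := (Real.log_pos one_lt_two).ne'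
  unfold bscCapacity
  field_simp

/-- The converse of the channel coding theorem: above capacity the error probability is eventually
at least one half. -/
theorem eventually_half_le_bscErrorProb {p R : ℝ} (hp : p ∈ Set.Icc (0 : ℝ) 1) (hR0 : 0 ≤ R)
    (hR : bscCapacity p < R) :
    ∀ᶠ n : ℕ in Filter.atTop, ∀ (X : Codebook n (numMessages n R))
      (dec : Word n → Fin (numMessages n R)), 1 / 2 ≤ bscErrorProb p X dec := by
  have hl2 : 0 < Real.log 2 := Real.log_pos one_lt_two
  have hgap : bscCapacity p * Real.log 2 < R * Real.log 2 := mul_lt_mul_of_pos_right hR hl2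
  rw [log_two_mul_bscCapacity] at hgap
  -- Half the gap to capacity, in nats: one `δ` pays for typicality, the other gives the decay
  -- $e^{-n\delta}$.
  obtain ⟨δ, hδ⟩ : ∃ δ, 2 * δ = R * Real.log 2 - (Real.log 2 - Real.binEntropy p) :=
    ⟨_, mul_div_cancel₀ _ two_ne_zero⟩
  have hδ0 : 0 < δ := by linarith
  have ht := (tendsto_div_nat_mul (infoVariance p) (δ ^ 2)).add (tendsto_exp_neg_nat_mul hδ0)
  rw [add_zero] at ht
  filter_upwards [ht.eventually_lt_const (show (0 : ℝ) < 1 / 2 by norm_num),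
    Filter.eventually_gt_atTop 0] with n hn hn0 X dec
  have hM : 0 < numMessages n R := one_le_numMessages n hR0
  have hM' : (0 : ℝ) < numMessages n R := by exact_mod_cast hM
  have h := one_sub_bscErrorProb_le hp hδ0 hn0 hM X dec
  have h2 : ((numMessages n R : ℕ) : ℝ)⁻¹ * (2 ^ n * Real.exp (-(n * (Real.binEntropy p - δ)))) ≤
      2 * Real.exp (-(n * δ)) := by
    rw [inv_mul_le_iff₀ hM']
    calc (2 : ℝ) ^ n * Real.exp (-(n * (Real.binEntropy p - δ)))
        = Real.exp (n * (R * Real.log 2)) * Real.exp (-(n * δ)) := by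
          rw [← Real.exp_log (show (0 : ℝ) < 2 ^ n by positivity), Real.log_pow, ← Real.exp_add,
            ← Real.exp_add]
          congr 1
          linear_combination (n : ℝ) * hδ
      _ ≤ 2 * numMessages n R * Real.exp (-(n * δ)) :=
          mul_le_mul_of_nonneg_right (le_two_mul_numMessages n hR0) (Real.exp_pos _).le
      _ = _ := by ring
  linarith

end PointToPoint

/-! ### Linear codes below capacity -/

section LinearCodes

/-- Multiplication in the field with `2 ^ n` elements, read off in coordinates. -/
theorem exists_linear_family {n : ℕ} (hn : n ≠ 0) :
    ∃ E : {w : Word n // w ≠ 0} → (Word n →ₗ[ZMod 2] Word n),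
      (∀ w, Function.Injective (E w)) ∧ ∀ v ≠ 0, Function.Injective fun w => E w v := by
  have : Fact (Nat.Prime 2) := ⟨Nat.prime_two⟩
  let φ : GaloisField 2 n ≃ₗ[ZMod 2] Word n :=
    LinearEquiv.ofFinrankEq _ _ (by rw [GaloisField.finrank 2 hn]; simp)
  -- A field has no zero divisors, which gives injectivity in either factor when the other is
  -- nonzero.
  refine ⟨fun w => φ.toLinearMap ∘ₗ LinearMap.mulLeft (ZMod 2) (φ.symm w) ∘ₗ φ.symm.toLinearMap,
    fun w => ?_, fun v hv => ?_⟩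
  · have hw : φ.symm w ≠ 0 := by simpa using w.2
    intro a b hab
    simpa [hw] using hab
  · have hv' : φ.symm v ≠ 0 := by simpa using hv
    intro a b hab
    simpa [hv, Subtype.ext_iff] using hab

/-- Rows of $G$ are independent exactly when $v \mapsto vG$ is injective. -/
theorem isLinearCodebook_of_injective {n M : ℕ}
    (L : Word (Nat.clog 2 M) →ₗ[ZMod 2] Word n) (hL : Function.Injective L)
    (u : Fin M → Word (Nat.clog 2 M)) (hu : Function.Injective u) :
    IsLinearCodebook fun m => L (u m) := by
  have h (v : Word (Nat.clog 2 M)) : Matrix.vecMul v (LinearMap.toMatrix' L).transpose = L v := by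
    rw [Matrix.vecMul_transpose, LinearMap.toMatrix'_mulVec]
  refine ⟨(LinearMap.toMatrix' L).transpose, u, ?_, hu, fun m => (h _).symm⟩
  rw [← Matrix.vecMul_injective_iff]
  intro a b hab
  exact hL (by simpa only [h] using hab)

theorem exists_injective_fin_word (M : ℕ) :
    ∃ u : Fin M → Word (Nat.clog 2 M), Function.Injective u := by
  have : Nonempty (Fin M ↪ Word (Nat.clog 2 M)) :=
    Function.Embedding.nonempty_of_card_le (by simpa using Nat.le_pow_clog one_lt_two M)
  exact ⟨this.some, this.some.injective⟩

theorem exists_injective_linearMap_word {k n : ℕ} (hkn : k ≤ n) :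
    ∃ J : Word k →ₗ[ZMod 2] Word n, Function.Injective J := by
  refine ⟨Function.ExtendByZero.linearMap (ZMod 2) (Fin.castLE hkn), fun a b hab => ?_⟩
  funext i
  have h : Function.extend (Fin.castLE hkn) a 0 (Fin.castLE hkn i) =
      Function.extend (Fin.castLE hkn) b 0 (Fin.castLE hkn i) := congrFun hab (Fin.castLE hkn i)
  rwa [(Fin.castLE_injective hkn).extend_apply, (Fin.castLE_injective hkn).extend_apply] at h

open Classical in
/-- The error probability of typical-set decoding. -/
theorem exists_decoder_bscErrorProb_le {p δ : ℝ} (hp : p ∈ Set.Icc (0 : ℝ) 1) (hδ : 0 < δ)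
    {n M : ℕ} (hn : 0 < n) (hM : 0 < M) (X : Codebook n M) :
    ∃ dec : Word n → Fin M, bscErrorProb p X dec ≤ infoVariance p / (n * δ ^ 2) +
      ∑ m : Fin M, (M : ℝ)⁻¹ * ∑ z : Word n, (∏ i, flipProb p (z i)) *
        ∑ m' ∈ Finset.univ.erase m,
          (if z + (X m - X m') ∈ typicalSet p δ n then (1 : ℝ) else 0) := by
  have hM' : (0 : ℝ) < M := by exact_mod_cast hM
  -- Any message that makes the noise typical is accepted; message 0 is a dummy. An error then
  -- requires atypical noise or a second message that also explains the output.
  let dec : Word n → Fin M := fun y =>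
    if h : ∃ m, y - X m ∈ typicalSet p δ n then h.choose else ⟨0, hM⟩
  have hdec (y : Word n) (h : ∃ m, y - X m ∈ typicalSet p δ n) :
      y - X (dec y) ∈ typicalSet p δ n := by
    simp only [dec, h, dif_pos]
    exact h.choose_spec
  refine ⟨dec, ?_⟩
  have hA := sum_not_typical_le hp hδ hn
  have hone : infoVariance p / (n * δ ^ 2) =
      ∑ _m : Fin M, (M : ℝ)⁻¹ * (infoVariance p / (n * δ ^ 2)) := by
    rw [← Finset.mul_sum, Finset.sum_const, Finset.card_univ, Fintype.card_fin, nsmul_eq_mul,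
      inv_mul_cancel_left₀ hM'.ne']
  rw [hone, ← Finset.sum_add_distrib, bscErrorProb]
  refine Finset.sum_le_sum fun m _ => ?_
  rw [← mul_add]
  refine mul_le_mul_of_nonneg_left ?_ (by positivity)
  refine le_trans ?_ (add_le_add_left hA _)
  rw [sum_bsc_mul, ← Finset.sum_add_distrib]
  refine Finset.sum_le_sum fun z _ => ?_
  rw [← mul_add]
  refine mul_le_mul_of_nonneg_left ?_ (Finset.prod_nonneg fun i _ => flipProb_nonneg hp _)
  have hnn : ∀ m' ∈ Finset.univ.erase m,
      (0 : ℝ) ≤ if z + (X m - X m') ∈ typicalSet p δ n then (1 : ℝ) else 0 := by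
    intro m' _
    split_ifs <;> norm_num
  have hs := Finset.sum_nonneg hnn
  by_cases hz : z ∈ typicalSet p δ n
  · by_cases hd : dec (X m + z) = m
    · simp [hd, hz]
    · have hmem := hdec (X m + z) ⟨m, by simpa using hz⟩
      have h1 := Finset.single_le_sum hnn
        (Finset.mem_erase.2 ⟨hd, Finset.mem_univ (dec (X m + z))⟩)
      rw [if_pos (by convert hmem using 1; abel)] at h1
      simpa [hd, hz] using h1
  · have h1 : (if dec (X m + z) ≠ m then (1 : ℝ) else 0) ≤ 1 := by split_ifs <;> norm_num
    simp only [hz, if_false]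
    linarith

open Classical in
-- The multiplier $w$ replaces a random generator matrix. For two distinct messages the codeword
-- difference is $w v$ with a fixed $v \ne 0$, hence takes each value for at most one $w$. So at
-- most as many $w$ confuse the pair as there are typical words, and some $w$ does no worse than
-- average.
theorem exists_linear_bscErrorProb_le {p δ : ℝ} (hp : p ∈ Set.Icc (0 : ℝ) 1) (hδ : 0 < δ)
    {n M : ℕ} (hn : 0 < n) (hM : 0 < M) (hk : Nat.clog 2 M ≤ n) :
    ∃ X ∈ linearCodes n M, ∃ dec : Word n → Fin M,
      bscErrorProb p X dec ≤ infoVariance p / (n * δ ^ 2) +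
        2 * M * Real.exp (n * (Real.binEntropy p + δ)) / 2 ^ n := by
  have hM' : (0 : ℝ) < M := by exact_mod_cast hM
  obtain ⟨E, hE, hE'⟩ := exists_linear_family hn.ne'
  obtain ⟨u, hu⟩ := exists_injective_fin_word M
  obtain ⟨J, hJ⟩ := exists_injective_linearMap_word hk
  set τ := Real.exp (n * (Real.binEntropy p + δ)) with hτ
  set A := infoVariance p / (n * δ ^ 2) with hAdef
  let X : {w : Word n // w ≠ 0} → Codebook n M := fun w m => (E w ∘ₗ J) (u m)
  choose dec hdec using fun w => exists_decoder_bscErrorProb_le hp hδ hn hM (X w)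
  have hcard : (Fintype.card {w : Word n // w ≠ 0} : ℝ) + 1 = 2 ^ n := by
    have h := Fintype.card_subtype_compl fun w : Word n => w = 0
    have h1 : 1 ≤ 2 ^ n := Nat.one_le_two_pow
    simp only [Fintype.card_subtype_eq, Fintype.card_pi, ZMod.card, Finset.prod_const,
      Finset.card_univ, Fintype.card_fin] at h
    have h2 : Fintype.card {w : Word n // w ≠ 0} + 1 = 2 ^ n := by
      have : Fintype.card {w : Word n // w ≠ 0} = 2 ^ n - 1 := by convert h
      omega
    exact_mod_cast h2
  have h2n : (2 : ℝ) ≤ 2 ^ n := by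
    simpa using pow_le_pow_right₀ (one_le_two : (1 : ℝ) ≤ 2) hn
  have hne : (Finset.univ : Finset {w : Word n // w ≠ 0}).Nonempty := by
    rw [← Finset.card_pos, Finset.card_univ]
    have : (0 : ℝ) < Fintype.card {w : Word n // w ≠ 0} := by linarith
    exact_mod_cast this
  have hpair (m m' : Fin M) (hm : m' ≠ m) (z : Word n) :
      ∑ w, (if z + (X w m - X w m') ∈ typicalSet p δ n then (1 : ℝ) else 0) ≤ τ := by
    have hv : J (u m) - J (u m') ≠ 0 := fun h => hm (hu (hJ (sub_eq_zero.1 h))).symm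
    have hinj : Function.Injective fun w => z + E w (J (u m) - J (u m')) :=
      (add_right_injective z).comp (hE' _ hv)
    refine le_trans ?_ (sum_typical_le hp n)
    have hX (w) : X w m - X w m' = E w (J (u m) - J (u m')) := by simp [X]
    simp_rw [hX]
    rw [← Finset.sum_image (s := Finset.univ)
      (f := fun y => if y ∈ typicalSet p δ n then (1 : ℝ) else 0) (hinj.injOn)]
    refine Finset.sum_le_sum_of_subset_of_nonneg (Finset.subset_univ _) fun y _ _ => ?_
    split_ifs <;> norm_num
  have hsum : ∑ w, ∑ m : Fin M, (M : ℝ)⁻¹ * ∑ z : Word n, (∏ i, flipProb p (z i)) *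
        ∑ m' ∈ Finset.univ.erase m,
          (if z + (X w m - X w m') ∈ typicalSet p δ n then (1 : ℝ) else 0) ≤ M * τ := by
    have hz (m : Fin M) (z : Word n) : ∑ w, ∑ m' ∈ Finset.univ.erase m,
        (if z + (X w m - X w m') ∈ typicalSet p δ n then (1 : ℝ) else 0) ≤ M * τ := by
      rw [Finset.sum_comm]
      calc _ ≤ ∑ m' ∈ Finset.univ.erase m, τ :=
            Finset.sum_le_sum fun m' hm' => hpair m m' (Finset.ne_of_mem_erase hm') z
        _ ≤ ∑ m' : Fin M, τ := Finset.sum_le_sum_of_subset_of_nonneg (Finset.subset_univ _)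
            fun _ _ _ => (Real.exp_pos _).le
        _ = M * τ := by simp
    rw [Finset.sum_comm]
    have hm (m : Fin M) : ∑ w, (M : ℝ)⁻¹ * ∑ z : Word n, (∏ i, flipProb p (z i)) *
        ∑ m' ∈ Finset.univ.erase m,
          (if z + (X w m - X w m') ∈ typicalSet p δ n then (1 : ℝ) else 0) ≤
        (M : ℝ)⁻¹ * (M * τ) := by
      rw [← Finset.mul_sum, Finset.sum_comm]
      refine mul_le_mul_of_nonneg_left ?_ (by positivity)
      calc _ ≤ ∑ z : Word n, (∏ i, flipProb p (z i)) * (M * τ) := by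
            refine Finset.sum_le_sum fun z _ => ?_
            rw [← Finset.mul_sum]
            exact mul_le_mul_of_nonneg_left (hz m z)
              (Finset.prod_nonneg fun i _ => flipProb_nonneg hp _)
        _ = M * τ := by
            rw [← Finset.sum_mul, sum_prod_weight _ (sum_flipProb p), one_mul]
    refine (Finset.sum_le_sum fun m _ => hm m).trans_eq ?_
    rw [Finset.sum_const, Finset.card_univ, Fintype.card_fin, nsmul_eq_mul,
      mul_inv_cancel_left₀ hM'.ne']
  have hle : ∑ w, bscErrorProb p (X w) (dec w) ≤
      ∑ _w : {w : Word n // w ≠ 0}, (A + 2 * M * τ / 2 ^ n) := by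
    refine (Finset.sum_le_sum fun w _ => hdec w).trans ?_
    rw [Finset.sum_add_distrib, Finset.sum_add_distrib]
    refine add_le_add_right (hsum.trans ?_) _
    rw [Finset.sum_const, Finset.card_univ, nsmul_eq_mul, mul_div_assoc', le_div_iff₀ (by positivity)]
    -- There are $2^n - 1$ multipliers, and $2^n \le 2(2^n - 1)$ yields the factor 2.
    have : 0 < M * τ := mul_pos hM' (Real.exp_pos _)
    nlinarith
  obtain ⟨w, -, hw⟩ := Finset.exists_le_of_sum_le hne hle
  exact ⟨X w, isLinearCodebook_of_injective _ ((hE w).comp hJ) u hu, dec w, hw⟩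

/-- The direct part of the channel coding theorem for linear codes below capacity. -/
theorem eventually_exists_linear_of_lt_capacity {p R ε : ℝ} (hp : p ∈ Set.Icc (0 : ℝ) 1)
    (hR0 : 0 ≤ R) (hR : R < bscCapacity p) (hε : 0 < ε) :
    ∀ᶠ n : ℕ in Filter.atTop, ∃ X ∈ linearCodes n (numMessages n R),
      ∃ dec : Word n → Fin (numMessages n R), bscErrorProb p X dec < ε := by
  have hl2 : 0 < Real.log 2 := Real.log_pos one_lt_two
  have hgap : R * Real.log 2 < bscCapacity p * Real.log 2 := mul_lt_mul_of_pos_right hR hl2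
  rw [log_two_mul_bscCapacity] at hgap
  -- This lets the message labels fit into $n$ bits.
  have hR1 : R < 1 := by
    have := Real.binEntropy_nonneg hp.1 hp.2
    by_contra h
    nlinarith
  obtain ⟨δ, hδ⟩ : ∃ δ, 2 * δ = Real.log 2 - Real.binEntropy p - R * Real.log 2 :=
    ⟨_, mul_div_cancel₀ _ two_ne_zero⟩
  have hδ0 : 0 < δ := by linarith
  have ht := (tendsto_div_nat_mul (infoVariance p) (δ ^ 2)).add (tendsto_exp_neg_nat_mul hδ0)
  rw [add_zero] at ht
  have hlin : Filter.Tendsto (fun n : ℕ => (n : ℝ) * (1 - R)) Filter.atTop Filter.atTop :=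
    tendsto_natCast_atTop_atTop.atTop_mul_const (by linarith)
  filter_upwards [ht.eventually_lt_const hε, Filter.eventually_gt_atTop 0,
    hlin.eventually_ge_atTop 1] with n hn hn0 hn1
  have hk : Nat.clog 2 (numMessages n R) ≤ n := by
    refine Nat.clog_le_of_le_pow (Nat.floor_le_of_le ?_)
    rw [Nat.cast_pow, Nat.cast_ofNat, ← Real.rpow_natCast]
    exact Real.rpow_le_rpow_of_exponent_le one_le_two (by linarith)
  obtain ⟨X, hX, dec, h⟩ := exists_linear_bscErrorProb_le hp hδ0 hn0 (one_le_numMessages n hR0) hk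
  refine ⟨X, hX, dec, h.trans_lt (lt_of_le_of_lt (add_le_add_right ?_ _) hn)⟩
  rw [div_le_iff₀ (by positivity)]
  calc 2 * (numMessages n R : ℝ) * Real.exp (n * (Real.binEntropy p + δ))
      ≤ 2 * Real.exp (n * (R * Real.log 2)) * Real.exp (n * (Real.binEntropy p + δ)) := by
        have := numMessages_le n R
        gcongr
    _ = 2 * Real.exp (-(n * δ)) * 2 ^ n := by
        rw [← Real.exp_log (show (0 : ℝ) < 2 ^ n by positivity), Real.log_pow, mul_assoc,
          mul_assoc, ← Real.exp_add, ← Real.exp_add]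
        congr 2
        linear_combination (n : ℝ) * hδ

/-- Rate zero is admitted separately because the capacity may vanish; a single message is never
decoded wrongly. -/
theorem eventually_exists_linear {p R ε : ℝ} (hp : p ∈ Set.Icc (0 : ℝ) 1)
    (hR0 : 0 ≤ R) (hR : R < bscCapacity p ∨ R = 0) (hε : 0 < ε) :
    ∀ᶠ n : ℕ in Filter.atTop, ∃ X ∈ linearCodes n (numMessages n R),
      ∃ dec : Word n → Fin (numMessages n R), bscErrorProb p X dec < ε := by
  rcases hR with hR | rfl
  · exact eventually_exists_linear_of_lt_capacity hp hR0 hR hε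
  · refine Filter.Eventually.of_forall fun n => ?_
    have h1 : numMessages n 0 = 1 := by simp [numMessages]
    rw [h1]
    obtain ⟨u, hu⟩ := exists_injective_fin_word 1
    obtain ⟨J, hJ⟩ := exists_injective_linearMap_word (show Nat.clog 2 1 ≤ n by simp)
    refine ⟨_, isLinearCodebook_of_injective J hJ u hu, fun _ => 0, ?_⟩
    simpa [bscErrorProb] using hε

end LinearCodes

/-! ### Reduction of serial decoding to two channels -/

section Serial

variable {p13 p14 p23 p34 : ℝ} {n MA MB : ℕ}

/-- The cascade adds noise to $x + x'$, so subtracting $x$ leaves the same noise on $x'$. -/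
theorem sum_relay_mul (p13 p23 p34 : ℝ) (x x' : Word n) (F : Word n → ℝ) :
    ∑ y13 : Word n, ∑ y23 : Word n, ∑ y34 : Word n,
        bsc p13 x y13 * bsc p23 x' y23 * bsc p34 (y13 + y23) y34 * F (y34 - x) =
      ∑ y, bsc (cascadeCrossover p13 p23 p34) x' y * F y := by
  calc _ = ∑ y34 : Word n, bsc (cascadeCrossover p13 p23 p34) (x + x') y34 * F (y34 - x) := by
        simp_rw [← cascade_eq_bsc, Finset.sum_mul]
        exact (Finset.sum_congr rfl fun _ _ => Finset.sum_comm).trans Finset.sum_comm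
    _ = _ := by
        rw [sum_bsc_mul, sum_bsc_mul]
        refine Finset.sum_congr rfl fun z _ => ?_
        congr 2
        abel

open Classical in
/-- Serial decoding fails exactly if one of two independent point-to-point codes fails. -/
theorem serialErrorProb_eq (p13 p14 p23 p34 : ℝ) (XA : Codebook n MA) (XB : Codebook n MB)
    (decA : Word n → Fin MA) (decB : Word n → Fin MB) :
    serialErrorProb p13 p14 p23 p34 XA XB decA decB =
      ∑ a : Fin MA, ∑ b : Fin MB, ((MA : ℝ)⁻¹ * (MB : ℝ)⁻¹) *
        ∑ y : Word n, ∑ y' : Word n, bsc p14 (XA a) y *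
          bsc (cascadeCrossover p13 p23 p34) (XB b) y' *
            (if decA y ≠ a ∨ decB y' ≠ b then 1 else 0) := by
  refine Finset.sum_congr rfl fun a _ => Finset.sum_congr rfl fun b _ => ?_
  congr 1
  rw [Finset.sum_comm]
  refine Finset.sum_congr rfl fun y14 _ => ?_
  simp_rw [mul_assoc (bsc p14 (XA a) y14)]
  rw [← Finset.mul_sum, ← sum_relay_mul p13 p23 p34 (XA a) (XB b)
    fun y' => if decA y14 ≠ a ∨ decB y' ≠ b then (1 : ℝ) else 0, Finset.mul_sum]
  refine Finset.sum_congr rfl fun y13 _ => ?_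
  rw [Finset.mul_sum]
  refine Finset.sum_congr rfl fun y23 _ => ?_
  rw [Finset.mul_sum]
  refine Finset.sum_congr rfl fun y34 _ => ?_
  -- If the first estimate is wrong, both sides hold whatever `decB` receives; otherwise the
  -- subtracted codewords agree.
  have hiff : (decA y14, decB (y34 - XA (decA y14))) ≠ (a, b) ↔
      decA y14 ≠ a ∨ decB (y34 - XA a) ≠ b := by
    by_cases h : decA y14 = a <;> simp [h]
  simp only [hiff]
  ring

open Classical in
-- Averaging over the other, irrelevant link gives the form in which error events can be compared
-- termwise.
theorem bscErrorProb_eq_left (p q : ℝ) (hMB : 0 < MB) (XA : Codebook n MA) (XB : Codebook n MB)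
    (decA : Word n → Fin MA) :
    bscErrorProb p XA decA = ∑ a : Fin MA, ∑ b : Fin MB, ((MA : ℝ)⁻¹ * (MB : ℝ)⁻¹) *
        ∑ y : Word n, ∑ y' : Word n, bsc p (XA a) y * bsc q (XB b) y' *
          (if decA y ≠ a then 1 else 0) := by
  have hMB' : (MB : ℝ) ≠ 0 := by exact_mod_cast hMB.ne'
  refine Finset.sum_congr rfl fun a _ => ?_
  have h (b : Fin MB) : ∑ y : Word n, ∑ y' : Word n, bsc p (XA a) y * bsc q (XB b) y' *
      (if decA y ≠ a then (1 : ℝ) else 0) =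
        ∑ y : Word n, bsc p (XA a) y * (if decA y ≠ a then 1 else 0) := by
    refine Finset.sum_congr rfl fun y _ => ?_
    rw [← Finset.sum_mul, ← Finset.mul_sum, sum_bsc, mul_one]
  simp_rw [h]
  rw [Finset.sum_const, Finset.card_univ, Fintype.card_fin, nsmul_eq_mul]
  field_simp

open Classical in
theorem bscErrorProb_eq_right (p q : ℝ) (hMA : 0 < MA) (XA : Codebook n MA) (XB : Codebook n MB)
    (decB : Word n → Fin MB) :
    bscErrorProb q XB decB = ∑ a : Fin MA, ∑ b : Fin MB, ((MA : ℝ)⁻¹ * (MB : ℝ)⁻¹) *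
        ∑ y : Word n, ∑ y' : Word n, bsc p (XA a) y * bsc q (XB b) y' *
          (if decB y' ≠ b then 1 else 0) := by
  rw [bscErrorProb_eq_left q p hMA XB XA decB, Finset.sum_comm]
  refine Finset.sum_congr rfl fun a _ => Finset.sum_congr rfl fun b _ => ?_
  rw [Finset.sum_comm, mul_comm (MB : ℝ)⁻¹]
  simp_rw [mul_comm (bsc q _ _)]

theorem bscErrorProb_left_le_serialErrorProb (h13 : p13 ∈ Set.Icc (0 : ℝ) 1)
    (h14 : p14 ∈ Set.Icc (0 : ℝ) 1) (h23 : p23 ∈ Set.Icc (0 : ℝ) 1)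
    (h34 : p34 ∈ Set.Icc (0 : ℝ) 1) (hMB : 0 < MB) (XA : Codebook n MA) (XB : Codebook n MB)
    (decA : Word n → Fin MA) (decB : Word n → Fin MB) :
    bscErrorProb p14 XA decA ≤ serialErrorProb p13 p14 p23 p34 XA XB decA decB := by
  have hq := cascadeCrossover_mem h13 h23 h34
  rw [serialErrorProb_eq, bscErrorProb_eq_left p14 (cascadeCrossover p13 p23 p34) hMB XA XB]
  gcongr with a _ b _ y _ y' _
  · exact mul_nonneg (bsc_nonneg h14 _ _) (bsc_nonneg hq _ _)
  · split_ifs <;> first | tauto | norm_num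

theorem bscErrorProb_right_le_serialErrorProb (h13 : p13 ∈ Set.Icc (0 : ℝ) 1)
    (h14 : p14 ∈ Set.Icc (0 : ℝ) 1) (h23 : p23 ∈ Set.Icc (0 : ℝ) 1)
    (h34 : p34 ∈ Set.Icc (0 : ℝ) 1) (hMA : 0 < MA) (XA : Codebook n MA) (XB : Codebook n MB)
    (decA : Word n → Fin MA) (decB : Word n → Fin MB) :
    bscErrorProb (cascadeCrossover p13 p23 p34) XB decB ≤
      serialErrorProb p13 p14 p23 p34 XA XB decA decB := by
  have hq := cascadeCrossover_mem h13 h23 h34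
  rw [serialErrorProb_eq, bscErrorProb_eq_right p14 (cascadeCrossover p13 p23 p34) hMA XA XB]
  gcongr with a _ b _ y _ y' _
  · exact mul_nonneg (bsc_nonneg h14 _ _) (bsc_nonneg hq _ _)
  · split_ifs <;> first | tauto | norm_num

/-- The union bound. -/
theorem serialErrorProb_le_add (h13 : p13 ∈ Set.Icc (0 : ℝ) 1)
    (h14 : p14 ∈ Set.Icc (0 : ℝ) 1) (h23 : p23 ∈ Set.Icc (0 : ℝ) 1)
    (h34 : p34 ∈ Set.Icc (0 : ℝ) 1) (hMA : 0 < MA) (hMB : 0 < MB)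
    (XA : Codebook n MA) (XB : Codebook n MB)
    (decA : Word n → Fin MA) (decB : Word n → Fin MB) :
    serialErrorProb p13 p14 p23 p34 XA XB decA decB ≤
      bscErrorProb p14 XA decA + bscErrorProb (cascadeCrossover p13 p23 p34) XB decB := by
  have hq := cascadeCrossover_mem h13 h23 h34
  rw [serialErrorProb_eq, bscErrorProb_eq_right p14 (cascadeCrossover p13 p23 p34) hMA XA XB,
    bscErrorProb_eq_left p14 (cascadeCrossover p13 p23 p34) hMB XA XB]
  simp_rw [← Finset.sum_add_distrib, ← mul_add, ← Finset.sum_add_distrib, ← mul_add]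
  gcongr with a _ b _ y _ y' _
  · exact mul_nonneg (bsc_nonneg h14 _ _) (bsc_nonneg hq _ _)
  · split_ifs <;> first | tauto | norm_num

end Serial

/-! ### The rate region -/

section Region

variable {p13 p14 p23 p34 : ℝ}

theorem SerialAchievable.mono {codes codes' : ∀ n M : ℕ, Set (Codebook n M)}
    (hc : ∀ n M, codes n M ⊆ codes' n M) {R : ℝ × ℝ}
    (h : SerialAchievable codes p13 p14 p23 p34 R) :
    SerialAchievable codes' p13 p14 p23 p34 R := by
  refine ⟨h.1, h.2.1, fun ε hε => ?_⟩
  obtain ⟨N, hN⟩ := h.2.2 ε hε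
  refine ⟨N, fun n hn => ?_⟩
  obtain ⟨XA, hA, XB, hB, dec⟩ := hN n hn
  exact ⟨XA, hc _ _ hA, XB, hc _ _ hB, dec⟩

theorem SerialAchievable.le_capacity (h13 : p13 ∈ Set.Icc (0 : ℝ) 1)
    (h14 : p14 ∈ Set.Icc (0 : ℝ) 1) (h23 : p23 ∈ Set.Icc (0 : ℝ) 1)
    (h34 : p34 ∈ Set.Icc (0 : ℝ) 1) {R : ℝ × ℝ}
    (h : SerialAchievable allCodes p13 p14 p23 p34 R) :
    R.1 ≤ bscCapacity p14 ∧ R.2 ≤ bscCapacity (cascadeCrossover p13 p23 p34) := by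
  obtain ⟨hA, hB, h⟩ := h
  obtain ⟨N, hN⟩ := h (1 / 2) (by norm_num)
  constructor
  · by_contra! hlt
    obtain ⟨n, hn, hnN⟩ := ((eventually_half_le_bscErrorProb h14 hA hlt).and
      (Filter.eventually_ge_atTop N)).exists
    obtain ⟨XA, -, XB, -, decA, decB, he⟩ := hN n hnN
    have := bscErrorProb_left_le_serialErrorProb h13 h14 h23 h34 (one_le_numMessages n hB)
      XA XB decA decB
    linarith [hn XA decA]
  · by_contra! hlt
    obtain ⟨n, hn, hnN⟩ := ((eventually_half_le_bscErrorProb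
      (cascadeCrossover_mem h13 h23 h34) hB hlt).and (Filter.eventually_ge_atTop N)).exists
    obtain ⟨XA, -, XB, -, decA, decB, he⟩ := hN n hnN
    have := bscErrorProb_right_le_serialErrorProb h13 h14 h23 h34 (one_le_numMessages n hA)
      XA XB decA decB
    linarith [hn XB decB]

theorem serialAchievable_linearCodes (h13 : p13 ∈ Set.Icc (0 : ℝ) 1)
    (h14 : p14 ∈ Set.Icc (0 : ℝ) 1) (h23 : p23 ∈ Set.Icc (0 : ℝ) 1)
    (h34 : p34 ∈ Set.Icc (0 : ℝ) 1) {R : ℝ × ℝ} (hA0 : 0 ≤ R.1) (hB0 : 0 ≤ R.2)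
    (hA : R.1 < bscCapacity p14 ∨ R.1 = 0)
    (hB : R.2 < bscCapacity (cascadeCrossover p13 p23 p34) ∨ R.2 = 0) :
    SerialAchievable linearCodes p13 p14 p23 p34 R := by
  refine ⟨hA0, hB0, fun ε hε => ?_⟩
  obtain ⟨N, hN⟩ := Filter.eventually_atTop.1
    ((eventually_exists_linear h14 hA0 hA (half_pos hε)).and
      (eventually_exists_linear (cascadeCrossover_mem h13 h23 h34) hB0 hB (half_pos hε)))
  refine ⟨N, fun n hn => ?_⟩
  obtain ⟨⟨XA, hXA, decA, heA⟩, XB, hXB, decB, heB⟩ := hN n hn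
  refine ⟨XA, hXA, XB, hXB, decA, decB, ?_⟩
  have := serialErrorProb_le_add h13 h14 h23 h34 (one_le_numMessages n hA0)
    (one_le_numMessages n hB0) XA XB decA decB
  linarith

/-- Shrinking towards the origin brings a rate strictly below capacity unless it is zero, which
covers $c = 0$. -/
theorem lt_or_eq_zero_of_scaled {t r c : ℝ} (ht : t ∈ Set.Ioo (0 : ℝ) 1) (hr0 : 0 ≤ r)
    (hr : r ≤ c) : t * r < c ∨ t * r = 0 := by
  rcases hr0.eq_or_lt with rfl | h
  · right
    simp
  · left
    nlinarith [ht.2]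

theorem serialRegion_eq_of_between (h13 : p13 ∈ Set.Icc (0 : ℝ) 1)
    (h14 : p14 ∈ Set.Icc (0 : ℝ) 1) (h23 : p23 ∈ Set.Icc (0 : ℝ) 1)
    (h34 : p34 ∈ Set.Icc (0 : ℝ) 1) {codes : ∀ n M : ℕ, Set (Codebook n M)}
    (hc : ∀ n M, linearCodes n M ⊆ codes n M) :
    serialRegion codes p13 p14 p23 p34 =
      convexHull ℝ {R : ℝ × ℝ | 0 ≤ R.1 ∧ 0 ≤ R.2 ∧
        R.1 ≤ bscCapacity p14 ∧ R.2 ≤ bscCapacity (cascadeCrossover p13 p23 p34)} := by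
  have hbox : {R : ℝ × ℝ | 0 ≤ R.1 ∧ 0 ≤ R.2 ∧
      R.1 ≤ bscCapacity p14 ∧ R.2 ≤ bscCapacity (cascadeCrossover p13 p23 p34)} =
      Set.Icc (0 : ℝ) (bscCapacity p14) ×ˢ
        Set.Icc (0 : ℝ) (bscCapacity (cascadeCrossover p13 p23 p34)) := by
    ext R
    simp only [Set.mem_ofPred_eq, Set.mem_prod, Set.mem_Icc]
    tauto
  -- A product of intervals is convex, so taking the hull adds nothing.
  rw [hbox, ((convex_Icc _ _).prod (convex_Icc _ _)).convexHull_eq]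
  refine (closure_minimal (fun R hR => ?_) (isClosed_Icc.prod isClosed_Icc)).antisymm ?_
  · have h := (hR.mono (codes' := allCodes) fun _ _ => Set.subset_univ _).le_capacity
      h13 h14 h23 h34
    exact ⟨⟨hR.1, h.1⟩, ⟨hR.2.1, h.2⟩⟩
  · rintro R ⟨hA, hB⟩
    -- Boundary points of the box are limits of achievable points along the ray from the origin.
    have hlim : Filter.Tendsto (fun t : ℝ => (t * R.1, t * R.2)) (nhdsWithin 1 (Set.Iio 1))
        (nhds R) := by
      have hcont : Continuous fun t : ℝ => (t * R.1, t * R.2) := by fun_prop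
      simpa using (hcont.tendsto 1).mono_left nhdsWithin_le_nhds
    refine mem_closure_of_tendsto hlim ?_
    filter_upwards [Ioo_mem_nhdsLT (zero_lt_one' ℝ)] with t ht
    exact (serialAchievable_linearCodes h13 h14 h23 h34 (mul_nonneg ht.1.le hA.1)
      (mul_nonneg ht.1.le hB.1) (lt_or_eq_zero_of_scaled ht hA.1 hA.2)
      (lt_or_eq_zero_of_scaled ht hB.1 hB.2)).mono hc

end Region

end SerialDecoding

open SerialDecoding in
theorem theorem2 (p13 p14 p23 p34 : ℝ)
    (h13 : p13 ∈ Set.Icc (0 : ℝ) 1) (h14 : p14 ∈ Set.Icc (0 : ℝ) 1)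
    (h23 : p23 ∈ Set.Icc (0 : ℝ) 1) (h34 : p34 ∈ Set.Icc (0 : ℝ) 1) :
    (∀ (n : ℕ) (x13 x23 y34 : Word n),
      ∑ y13 : Word n, ∑ y23 : Word n, bsc p13 x13 y13 * bsc p23 x23 y23 * bsc p34 (y13 + y23) y34 =
        bsc (cascadeCrossover p13 p23 p34) (x13 + x23) y34) ∧
    serialRegion linearCodes p13 p14 p23 p34 =
      convexHull ℝ {R : ℝ × ℝ | 0 ≤ R.1 ∧ 0 ≤ R.2 ∧
        R.1 ≤ bscCapacity p14 ∧ R.2 ≤ bscCapacity (cascadeCrossover p13 p23 p34)} ∧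
    serialRegion allCodes p13 p14 p23 p34 =
      convexHull ℝ {R : ℝ × ℝ | 0 ≤ R.1 ∧ 0 ≤ R.2 ∧
        R.1 ≤ bscCapacity p14 ∧ R.2 ≤ bscCapacity (cascadeCrossover p13 p23 p34)} := by
  exact ⟨fun _ x13 x23 y34 => cascade_eq_bsc p13 p23 p34 x13 x23 y34,
    serialRegion_eq_of_between h13 h14 h23 h34 fun _ _ => subset_rfl,
    serialRegion_eq_of_between h13 h14 h23 h34 fun _ _ => Set.subset_univ _⟩
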